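/- Let $R$ be a commutative noetherian ring with unity, $\mathfrak a$ an ideal of $R$ and $M$ an $R$-module. For an $R$-module $N$ put $\Lambda^{\mathfrak a}(N):=\varprojlim_n N/\mathfrak a^nN$, which is an additive functor on $R$-modules, and for $i\ge 0$ let the $i$-th local homology module of $N$ with respect to $\mathfrak a$ be $H^{\mathfrak a}_i(N):=H_i\bigl(\Lambda^{\mathfrak a}(P)\bigr)$, where $P$ is any projective resolution of $N$. Then for every $j\ge 0$ there is an isomorphism of $R$-modules $$H^{\mathfrak a}_0\bigl(H^{\mathfrak a}_j(M)\bigr)\cong H^{\mathfrak a}_j(M),\qquad\text{and}\qquad H^{\mathfrak a}_i\bigl(H^{\mathfrak a}_j(M)\bigr)=0\quad\text{for every } i\ge 1.$$ -/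

import Mathlib

open CategoryTheory CategoryTheory.Limits

universe v u

namespace LocalHomology

variable {R : Type u} [CommRing R] (𝔞 : Ideal R)

/-- The `𝔞`-adic completion functor `Λ^𝔞` on `R`-modules: it sends `M` to `lim M / 𝔞ⁿ M`
(Mathlib's `AdicCompletion`, regarded as an `R`-module) and `f` to the induced map on completions. -/
noncomputable def completionFunctor : ModuleCat.{v} R ⥤ ModuleCat.{v} R where
  obj M := ModuleCat.of R (AdicCompletion 𝔞 M)
  map f := ModuleCat.ofHom ((AdicCompletion.map 𝔞 f.hom).restrictScalars R)
  map_id M := ModuleCat.hom_ext <| LinearMap.ext fun x =>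
    LinearMap.congr_fun (AdicCompletion.map_id 𝔞 M) x
  map_comp f g := ModuleCat.hom_ext <| LinearMap.ext fun x =>
    (AdicCompletion.map_comp_apply 𝔞 f.hom g.hom x).symm

instance : (completionFunctor.{v} 𝔞).Additive where
  map_add {M N f g} := ModuleCat.hom_ext <| LinearMap.ext fun (x : AdicCompletion 𝔞 M) => by
    change AdicCompletion.map 𝔞 (f.hom + g.hom) x =
      AdicCompletion.map 𝔞 f.hom x + AdicCompletion.map 𝔞 g.hom x
    induction x using AdicCompletion.induction_on
    simp only [AdicCompletion.map_mk, ← map_add]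
    rfl

/-- The `i`-th local homology module `H^𝔞_i(M) = H_i(Λ^𝔞(P))`, where `P` is a projective resolution
of `M`: the `i`-th left derived functor of the `𝔞`-adic completion functor. -/
noncomputable def localHomology [Small.{v} R] (i : ℕ) (M : ModuleCat.{v} R) : ModuleCat.{v} R :=
  ((completionFunctor.{v} 𝔞).leftDerived i).obj M

/-- Local homology is computed by any projective resolution. -/
noncomputable def localHomologyIso [Small.{v} R] (i : ℕ) {M : ModuleCat.{v} R}
    (P : ProjectiveResolution M) :
    localHomology 𝔞 i M ≅
      (((completionFunctor.{v} 𝔞).mapHomologicalComplex _).obj P.complex).homology i :=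
  P.isoLeftDerivedObj (completionFunctor.{v} 𝔞) i

end LocalHomology

/-! Completions are derived `x`-complete for `x ∈ 𝔞`, and this property passes to homology, so `N =
H_j(M)` is derived complete (`derivedComplete_localHomology`). It remains to show that for such `N`,
with projective resolution `P`, the map `P → Λ(P)` is a quasi-isomorphism
(`completion_exact_of_derivedComplete`). Its cone has derived complete homology, since both `N` and
the homology of `Λ(P)` are derived complete. It is exact modulo `𝔞`, because `P/𝔞P ≅ Λ(P)/𝔞Λ(P)`,
and its terms are flat: over a noetherian ring, Artin–Rees makes completions of projectives flat. A
Nakayama argument for derived complete modules, run upwards from degree 0, shows that the cone is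
exact (`exact_of_exact_mod`). -/

namespace LocalHomology

/-! ### Derived complete modules and Nakayama's lemma. -/

section DerivedComplete

variable {R : Type*} [CommRing R] {A B C : Type*} [AddCommGroup A] [Module R A]
  [AddCommGroup B] [Module R B] [AddCommGroup C] [Module R C]

theorem map_mem_smul_top {I : Ideal R} (φ : A →ₗ[R] B) {z : A}
    (hz : z ∈ I • (⊤ : Submodule R A)) : φ z ∈ I • (⊤ : Submodule R B) :=
  Submodule.smul_top_le_comap_smul_top I φ hz

/-- `N` is derived `x`-complete: the endomorphism `m ↦ (m k - x • m (k + 1))ₖ` of `ℕ → N`, whose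
kernel and cokernel are `Hom(R[1/x], N)` and `Ext¹(R[1/x], N)`, is bijective. -/
structure DerivedComplete (x : R) (N : Type*) [AddCommGroup N] [Module R N] : Prop where
  exists_sub : ∀ b : ℕ → N, ∃ m : ℕ → N, ∀ k, b k = m k - x • m (k + 1)
  eq_zero : ∀ m : ℕ → N, (∀ k, m k = x • m (k + 1)) → ∀ k, m k = 0

/-- The homology of `A → B → C` at `B` is derived `x`-complete, expressed with cycles. -/
structure HomologyDerivedComplete (x : R) (f : A →ₗ[R] B) (g : B →ₗ[R] C) : Prop where
  exists_sub : ∀ b : ℕ → B, (∀ k, g (b k) = 0) → ∃ (m : ℕ → B) (a : ℕ → A),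
    (∀ k, g (m k) = 0) ∧ ∀ k, b k = m k - x • m (k + 1) + f (a k)
  eq_boundary : ∀ (m : ℕ → B) (a : ℕ → A), (∀ k, g (m k) = 0) →
    (∀ k, m k - x • m (k + 1) = f (a k)) → ∀ k, ∃ a', f a' = m k

theorem DerivedComplete.homology {x : R} (hA : DerivedComplete x A) (hB : DerivedComplete x B)
    (hC : DerivedComplete x C) (f : A →ₗ[R] B) (g : B →ₗ[R] C) :
    HomologyDerivedComplete x f g where
  exists_sub b hb := by
    obtain ⟨m, hm⟩ := hB.exists_sub b
    refine ⟨m, 0, hC.eq_zero _ fun k => ?_, fun k => by simpa using hm k⟩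
    have h := hb k
    rwa [hm k, map_sub, map_smul, sub_eq_zero] at h
  eq_boundary m a _ hm k := by
    obtain ⟨a', ha'⟩ := hA.exists_sub a
    refine ⟨a' k, (sub_eq_zero.1 (hB.eq_zero (fun k => m k - f (a' k)) (fun k => ?_) k)).symm⟩
    have h := hm k
    rw [ha' k, map_sub, map_smul] at h
    rw [smul_sub, sub_eq_sub_iff_sub_eq_sub, h]

theorem HomologyDerivedComplete.of_exact (x : R) {f : A →ₗ[R] B} {g : B →ₗ[R] C}
    (h : ∀ b, g b = 0 → ∃ a, f a = b) : HomologyDerivedComplete x f g where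
  exists_sub b hb := by
    choose a ha using fun k => h (b k) (hb k)
    exact ⟨0, a, by simp, by simp [ha]⟩
  eq_boundary m _ hm _ k := h _ (hm k)

/-- `K` plays the cycles and `Q` the homology. Leaving both abstract covers the quotient `ker g / im
f` as well as categorical homology. -/
theorem HomologyDerivedComplete.derivedComplete {x : R} {f : A →ₗ[R] B} {g : B →ₗ[R] C}
    (h : HomologyDerivedComplete x f g) {K Q : Type*} [AddCommGroup K] [Module R K]
    [AddCommGroup Q] [Module R Q] (i : K →ₗ[R] B)
    (hig : ∀ b, g b = 0 ↔ ∃ z, i z = b) (p : K →ₗ[R] Q) (hp : Function.Surjective p)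
    (hpf : ∀ z, p z = 0 ↔ ∃ a, f a = i z) : DerivedComplete x Q where
  exists_sub b := by
    choose z hz using fun k => hp (b k)
    obtain ⟨m, a, hm, hma⟩ := h.exists_sub (fun k => i (z k)) fun k => (hig _).2 ⟨_, rfl⟩
    choose m' hm' using fun k => (hig _).1 (hm k)
    refine ⟨fun k => p (m' k), fun k => ?_⟩
    rw [← hz, ← map_smul, ← map_sub, ← sub_eq_zero, ← map_sub, hpf]
    exact ⟨a k, by simp [hm', hma]⟩
  eq_zero m hm k := by
    choose z hz using fun k => hp (m k)
    have : ∀ k, ∃ a, f a = i (z k - x • z (k + 1)) := fun k => by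
      rw [← hpf, map_sub, map_smul, hz, hz, ← hm, sub_self]
    choose a ha using this
    rw [← hz, hpf]
    exact h.eq_boundary _ a (fun k => (hig _).2 ⟨_, rfl⟩) (fun k => by simp [ha]) k

theorem HomologyDerivedComplete.of_cokernel {x : R} {Q : Type*} [AddCommGroup Q] [Module R Q]
    (hQ : DerivedComplete x Q) (f : A →ₗ[R] B) (g : B →ₗ[R] C) (hg : ∀ b, g b = 0) (p : B →ₗ[R] Q)
    (hp : Function.Surjective p) (hpf : ∀ b, p b = 0 ↔ ∃ a, f a = b) :
    HomologyDerivedComplete x f g where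
  exists_sub b _ := by
    obtain ⟨n, hn⟩ := hQ.exists_sub fun k => p (b k)
    choose m hm using fun k => hp (n k)
    have : ∀ k, ∃ a, f a = b k - (m k - x • m (k + 1)) := fun k => by
      rw [← hpf, map_sub, map_sub, map_smul, hm, hm, ← hn, sub_self]
    choose a ha using this
    exact ⟨m, a, fun k => hg _, fun k => by rw [ha]; abel⟩
  eq_boundary m a _ hm k := by
    rw [← hpf]
    refine hQ.eq_zero (fun k => p (m k)) (fun k => ?_) k
    rw [← sub_eq_zero, ← map_smul, ← map_sub, hm, hpf]
    exact ⟨_, rfl⟩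

/-- The quotient `Q / yQ` is the homology of `Q → Q → Q`, with maps `y` and `0`. -/
theorem DerivedComplete.quotient_smul {x : R} {Q : Type*} [AddCommGroup Q] [Module R Q]
    (hQ : DerivedComplete x Q) (y : R) :
    DerivedComplete x (Q ⧸ LinearMap.range (LinearMap.lsmul R Q y)) :=
  (hQ.homology hQ hQ (LinearMap.lsmul R Q y) (0 : Q →ₗ[R] Q)).derivedComplete LinearMap.id
    (by simp) (Submodule.mkQ _) (Submodule.mkQ_surjective _) (by simp)

theorem DerivedComplete.subsingleton {x : R} {Q : Type*} [AddCommGroup Q] [Module R Q]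
    (hQ : DerivedComplete x Q) (h : ∀ q : Q, ∃ q', x • q' = q) : Subsingleton Q := by
  refine subsingleton_of_forall_eq 0 fun q => ?_
  choose s hs using h
  -- Iterated division by `x` gives a solution of the homogeneous system starting at `q`.
  exact hQ.eq_zero (fun k => s^[k] q) (fun k => by rw [Function.iterate_succ_apply', hs]) 0

/-- Induction on generators: `Q / yQ` vanishes by the remaining ones, so `Q = yQ`, and a
`y`-divisible derived `y`-complete module is zero. -/
theorem subsingleton_of_span_smul_eq_top (s : Finset R) {Q : Type*} [AddCommGroup Q] [Module R Q]
    (hQ : ∀ x ∈ s, DerivedComplete x Q)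
    (h : Ideal.span (s : Set R) • (⊤ : Submodule R Q) = ⊤) : Subsingleton Q := by
  classical
  induction s using Finset.induction_on generalizing Q with
  | empty =>
    rw [Finset.coe_empty, Ideal.span_empty, Submodule.bot_smul] at h
    exact (Submodule.subsingleton_iff R).1 (subsingleton_of_bot_eq_top h)
  | insert y s _ ih =>
    let p := Submodule.mkQ (LinearMap.range (LinearMap.lsmul R Q y))
    have hp : Function.Surjective p := Submodule.mkQ_surjective _
    have hsub := ih (Q := Q ⧸ LinearMap.range (LinearMap.lsmul R Q y))
      (fun x hx => (hQ x (Finset.mem_insert_of_mem hx)).quotient_smul y) (by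
        rw [eq_top_iff]
        rintro q -
        obtain ⟨t, rfl⟩ := hp q
        have ht : t ∈ Ideal.span ((insert y s : Finset R) : Set R) • (⊤ : Submodule R Q) :=
          by rw [h]; exact Submodule.mem_top
        rw [Finset.coe_insert, Ideal.span_insert, Submodule.sup_smul,
          Submodule.ideal_span_singleton_smul] at ht
        obtain ⟨z, hz, w, hw, rfl⟩ := Submodule.mem_sup.1 ht
        obtain ⟨q, -, rfl⟩ := (Submodule.mem_smul_pointwise_iff_exists _ _ _).1 hz
        have hq : p (y • q) = 0 := (Submodule.Quotient.mk_eq_zero _).2 ⟨q, rfl⟩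
        rw [map_add, hq, zero_add]
        exact map_mem_smul_top p hw)
    refine (hQ y (Finset.mem_insert_self y s)).subsingleton fun q => ?_
    have : p q = 0 := Subsingleton.elim _ _
    exact (Submodule.Quotient.mk_eq_zero _).1 this

/-- Nakayama's lemma for the homology of a complex with derived complete homology. -/
theorem HomologyDerivedComplete.exact_of_le_smul {𝔞 : Ideal R} (h𝔞 : 𝔞.FG) {f : A →ₗ[R] B}
    {g : B →ₗ[R] C} (hfg : g.comp f = 0) (h : ∀ x ∈ 𝔞, HomologyDerivedComplete x f g)
    (hle : ∀ z : LinearMap.ker g, ∃ a, z - f.codRestrict (LinearMap.ker g)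
      (LinearMap.congr_fun hfg) a ∈ 𝔞 • (⊤ : Submodule R (LinearMap.ker g)))
    (b : B) (hb : g b = 0) : ∃ a, f a = b := by
  let f' := f.codRestrict (LinearMap.ker g) (LinearMap.congr_fun hfg)
  let p := Submodule.mkQ (LinearMap.range f')
  have hp : Function.Surjective p := Submodule.mkQ_surjective _
  obtain ⟨s, rfl⟩ := h𝔞
  have : Subsingleton (LinearMap.ker g ⧸ LinearMap.range f') := by
    refine subsingleton_of_span_smul_eq_top s (fun x hx => ?_) ?_
    · exact (h x (Ideal.subset_span hx)).derivedComplete (LinearMap.ker g).subtype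
        (by simp) p hp fun z => by
          simp only [p, Submodule.mkQ_apply, Submodule.Quotient.mk_eq_zero]
          exact exists_congr fun a => Subtype.ext_iff
    · rw [eq_top_iff]
      rintro q -
      obtain ⟨z, rfl⟩ := hp q
      obtain ⟨a, ha⟩ := hle z
      have h' := Submodule.mem_map_of_mem (f := p) ha
      rw [Submodule.map_smul'', Submodule.map_top, LinearMap.range_eq_top.2 hp, map_sub] at h'
      have h0 : p (f' a) = 0 := by simp [p]
      rwa [h0, sub_zero] at h'
  have h0 : p ⟨b, hb⟩ = 0 := Subsingleton.elim _ _
  obtain ⟨a, ha⟩ := (Submodule.Quotient.mk_eq_zero _).1 h0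
  exact ⟨a, congrArg Subtype.val ha⟩

end DerivedComplete

/-! ### Mapping cones. -/

section Cone

variable {R : Type*} [CommRing R]
  {P₀ P₁ P₂ P₃ C₀ C₁ C₂ C₃ : Type*}
  [AddCommGroup P₀] [Module R P₀] [AddCommGroup P₁] [Module R P₁]
  [AddCommGroup P₂] [Module R P₂] [AddCommGroup P₃] [Module R P₃]
  [AddCommGroup C₀] [Module R C₀] [AddCommGroup C₁] [Module R C₁]
  [AddCommGroup C₂] [Module R C₂] [AddCommGroup C₃] [Module R C₃]

/-- The differential of the mapping cone of `η`. -/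
def coneMap (d : P₁ →ₗ[R] P₀) (δ : C₂ →ₗ[R] C₁) (η : P₁ →ₗ[R] C₁) :
    P₁ × C₂ →ₗ[R] P₀ × C₁ :=
  (-(d.comp (LinearMap.fst R P₁ C₂))).prod
    (η.comp (LinearMap.fst R P₁ C₂) + δ.comp (LinearMap.snd R P₁ C₂))

@[simp]
theorem coneMap_apply (d : P₁ →ₗ[R] P₀) (δ : C₂ →ₗ[R] C₁) (η : P₁ →ₗ[R] C₁) (p : P₁) (c : C₂) :
    coneMap d δ η (p, c) = (-d p, η p + δ c) := rfl

theorem coneMap_comp {d₁ : P₁ →ₗ[R] P₀} {d₂ : P₂ →ₗ[R] P₁} {δ₂ : C₂ →ₗ[R] C₁}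
    {δ₃ : C₃ →ₗ[R] C₂} {η₁ : P₁ →ₗ[R] C₁} {η₂ : P₂ →ₗ[R] C₂}
    (hd : d₁.comp d₂ = 0) (hδ : δ₂.comp δ₃ = 0) (hη : η₁.comp d₂ = δ₂.comp η₂) :
    (coneMap d₁ δ₂ η₁).comp (coneMap d₂ δ₃ η₂) = 0 := by
  refine LinearMap.ext fun ⟨p, c⟩ => ?_
  have h1 := LinearMap.congr_fun hd p
  have h2 := LinearMap.congr_fun hδ c
  have h3 := LinearMap.congr_fun hη p
  simp only [LinearMap.comp_apply, LinearMap.zero_apply] at h1 h2 h3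
  simp [h1, h2, h3]

/-- An elementwise form of the long exact sequence of a cone. The hypotheses `hη₁` and `hη₃` stand
in for the chain map in the two outer degrees. -/
theorem HomologyDerivedComplete.cone {x : R} {d₁ : P₁ →ₗ[R] P₀} {d₂ : P₂ →ₗ[R] P₁}
    {d₃ : P₃ →ₗ[R] P₂} {δ₁ : C₁ →ₗ[R] C₀} {δ₂ : C₂ →ₗ[R] C₁} {δ₃ : C₃ →ₗ[R] C₂}
    {η₁ : P₁ →ₗ[R] C₁} {η₂ : P₂ →ₗ[R] C₂}
    (hδ₁ : δ₁.comp δ₂ = 0) (hδ₂ : δ₂.comp δ₃ = 0) (hd₁ : d₁.comp d₂ = 0)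
    (hη : η₁.comp d₂ = δ₂.comp η₂) (hη₁ : ∀ p, d₁ p = 0 → δ₁ (η₁ p) = 0)
    (hP₁ : HomologyDerivedComplete x d₂ d₁) (hP₂ : HomologyDerivedComplete x d₃ d₂)
    (hη₃ : ∀ p, ∃ c, δ₃ c = η₂ (d₃ p))
    (hC₁ : HomologyDerivedComplete x δ₂ δ₁) (hC₂ : HomologyDerivedComplete x δ₃ δ₂) :
    HomologyDerivedComplete x (coneMap d₂ δ₃ η₂) (coneMap d₁ δ₂ η₁) := by
  replace hδ₁ : ∀ c, δ₁ (δ₂ c) = 0 := LinearMap.congr_fun hδ₁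
  replace hδ₂ : ∀ c, δ₂ (δ₃ c) = 0 := LinearMap.congr_fun hδ₂
  replace hd₁ : ∀ c, d₁ (d₂ c) = 0 := LinearMap.congr_fun hd₁
  replace hη : ∀ p, η₁ (d₂ p) = δ₂ (η₂ p) := LinearMap.congr_fun hη
  constructor
  · intro b hb
    have hb1 : ∀ k, d₁ (b k).1 = 0 := fun k => by simpa [coneMap] using congrArg Prod.fst (hb k)
    have hb2 : ∀ k, η₁ (b k).1 + δ₂ (b k).2 = 0 := fun k => congrArg Prod.snd (hb k)
    obtain ⟨q, p', hq, hqp⟩ := hP₁.exists_sub (fun k => (b k).1) hb1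
    -- Modulo boundaries `-η₁ (q k)` solves the homogeneous system, so uniqueness in the homology at
    -- `C₁` applies.
    have hlift : ∀ k, ∃ e, δ₂ e = -η₁ (q k) := by
      refine hC₁.eq_boundary (fun k => -η₁ (q k)) (fun k => (b k).2 + η₂ (p' k))
        (fun k => by simp [hη₁ _ (hq k)]) fun k => ?_
      have h := hb2 k
      rw [hqp k, map_add, map_sub, map_smul, hη] at h
      rw [map_add, ← sub_eq_zero, ← neg_eq_zero.2 h, smul_neg]
      abel
    choose e he using hlift
    obtain ⟨m, c, hm, hmc⟩ := hC₂.exists_sub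
      (fun k => (b k).2 + η₂ (p' k) - e k + x • e (k + 1)) fun k => by
        have h := hb2 k
        rw [hqp k, map_add, map_sub, map_smul, hη] at h
        simp only [map_add, map_sub, map_smul, he]
        rw [← h, smul_neg]
        abel
    refine ⟨fun k => (q k, e k + m k), fun k => (-p' k, c k), fun k => ?_, fun k => ?_⟩
    · simp [hq, he, hm]
    · refine Prod.ext ?_ ?_
      · simpa using hqp k
      · have h := hmc k
        simp only [coneMap_apply, Prod.snd_add, Prod.snd_sub, Prod.smul_snd, map_neg]
        rw [← sub_eq_zero] at h ⊢
        rw [← h, smul_add]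
        abel
  · intro m a hm hma
    have hm1 : ∀ k, d₁ (m k).1 = 0 := fun k => by simpa [coneMap] using congrArg Prod.fst (hm k)
    have hm2 : ∀ k, η₁ (m k).1 + δ₂ (m k).2 = 0 := fun k => congrArg Prod.snd (hm k)
    have ha1 : ∀ k, (m k).1 - x • (m (k + 1)).1 = -d₂ (a k).1 :=
      fun k => congrArg Prod.fst (hma k)
    have ha2 : ∀ k, (m k).2 - x • (m (k + 1)).2 = η₂ (a k).1 + δ₃ (a k).2 :=
      fun k => congrArg Prod.snd (hma k)
    choose p hp using hP₁.eq_boundary (fun k => (m k).1) (fun k => -(a k).1) hm1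
      fun k => by simp [ha1]
    -- The preimages `p k` are unique only up to cycles; the cycles `r k` correct them to match `a`
    -- up to boundaries.
    obtain ⟨r, s, hr, hrs⟩ := hP₂.exists_sub (fun k => (a k).1 + (p k - x • p (k + 1))) fun k => by
      rw [map_add, map_sub, map_smul, hp, hp, ha1, add_neg_cancel]
    choose t ht using fun k => hη₃ (s k)
    have key : ∀ k, ∃ c, δ₃ c = (m k).2 + η₂ (p k) - η₂ (r k) := by
      refine hC₂.eq_boundary _ (fun k => (a k).2 + t k) (fun k => ?_) fun k => ?_
      · rw [map_sub, map_add, ← hη, ← hη, hp, hr, map_zero, sub_zero, add_comm, hm2]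
      · have h := congrArg η₂ (hrs k)
        simp only [map_add, map_sub, map_smul] at h
        have h' := ha2 k
        rw [map_add, ht, smul_sub, smul_add]
        rw [← sub_eq_zero] at h h' ⊢
        rw [← add_zero (0 : C₂)]
        nth_rewrite 1 [← h, ← h']
        abel
    intro k
    obtain ⟨c, hc⟩ := key k
    refine ⟨(-p k + r k, c), Prod.ext ?_ ?_⟩
    · simp [hp, hr]
    · simp only [coneMap_apply, hc, map_add, map_neg]
      abel

/-- If `η₂` is surjective and `η₁` injective modulo `𝔞`, the cone is exact there modulo `𝔞`. -/
theorem cone_exists_sub_mem_smul {𝔞 : Ideal R} {d₁ : P₁ →ₗ[R] P₀} {d₂ : P₂ →ₗ[R] P₁}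
    {δ₂ : C₂ →ₗ[R] C₁} (δ₃ : C₃ →ₗ[R] C₂) {η₁ : P₁ →ₗ[R] C₁} {η₂ : P₂ →ₗ[R] C₂}
    (hη : η₁.comp d₂ = δ₂.comp η₂)
    (hη₂ : ∀ c, ∃ q, c - η₂ q ∈ 𝔞 • (⊤ : Submodule R C₂))
    (hη₁ : ∀ p, η₁ p ∈ 𝔞 • (⊤ : Submodule R C₁) → p ∈ 𝔞 • (⊤ : Submodule R P₁))
    (e : P₁ × C₂) (he : coneMap d₁ δ₂ η₁ e ∈ 𝔞 • (⊤ : Submodule R (P₀ × C₁))) :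
    ∃ a, e - coneMap d₂ δ₃ η₂ a ∈ 𝔞 • (⊤ : Submodule R (P₁ × C₂)) := by
  obtain ⟨p, c⟩ := e
  obtain ⟨q, hq⟩ := hη₂ c
  have h1 : η₁ p + δ₂ c ∈ 𝔞 • (⊤ : Submodule R C₁) := map_mem_smul_top (LinearMap.snd R P₀ C₁) he
  have h2 : p + d₂ q ∈ 𝔞 • (⊤ : Submodule R P₁) := hη₁ _ <| by
    have h3 := sub_mem h1 (map_mem_smul_top δ₂ hq)
    have h4 := LinearMap.congr_fun hη q
    simp only [LinearMap.comp_apply] at h4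
    rw [map_add, h4]
    convert h3 using 1
    rw [map_sub]
    abel
  refine ⟨(q, 0), ?_⟩
  have h5 := add_mem (map_mem_smul_top (LinearMap.inl R P₁ C₂) h2)
    (map_mem_smul_top (LinearMap.inr R P₁ C₂) hq)
  convert h5 using 1
  simp

end Cone

/-! ### Lifting exactness from the reduction modulo an ideal. -/

section FlatKernel

variable {R : Type*} [CommRing R] {A B C : Type*} [AddCommGroup A] [Module R A]
  [AddCommGroup B] [Module R B] [AddCommGroup C] [Module R C]

theorem lTensor_ker_subtype_injective (g : B →ₗ[R] C) [Module.Flat R (LinearMap.range g)]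
    (T : Type*) [AddCommGroup T] [Module R T] :
    Function.Injective ((LinearMap.ker g).subtype.lTensor T) :=
  LinearMap.lTensor_injective_of_exact_of_flat g.rangeRestrict g.surjective_rangeRestrict _
    (Submodule.subtype_injective _) (fun b => by simp [Subtype.ext_iff]) T

theorem flat_ker (g : B →ₗ[R] C) [Module.Flat R B] [Module.Flat R (LinearMap.range g)] :
    Module.Flat R (LinearMap.ker g) := by
  rw [Module.Flat.iff_rTensor_injective']
  intro I
  have h := (Module.Flat.iff_rTensor_injective' (M := B)).1 ‹_› I
  have h' := h.comp (lTensor_ker_subtype_injective g I)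
  rw [← LinearMap.coe_comp, LinearMap.rTensor_comp_lTensor, ← LinearMap.lTensor_comp_rTensor,
    LinearMap.coe_comp] at h'
  exact h'.of_comp

/-- Flatness of the image kills `Tor₁` with `R ⧸ I`, so `ker g ∩ I B = I ker g`. -/
theorem mem_smul_top_ker (I : Ideal R) (g : B →ₗ[R] C) [Module.Flat R (LinearMap.range g)]
    (z : LinearMap.ker g) (hz : (z : B) ∈ I • (⊤ : Submodule R B)) :
    z ∈ I • (⊤ : Submodule R (LinearMap.ker g)) := by
  rw [← Submodule.Quotient.mk_eq_zero] at hz ⊢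
  apply (TensorProduct.quotTensorEquivQuotSMul _ I).symm.injective
  apply lTensor_ker_subtype_injective g (R ⧸ I)
  have h := congrArg (TensorProduct.quotTensorEquivQuotSMul B I).symm hz
  rw [TensorProduct.quotTensorEquivQuotSMul_symm_mk, map_zero] at h
  rw [TensorProduct.quotTensorEquivQuotSMul_symm_mk, map_zero, map_zero, LinearMap.lTensor_tmul]
  exact h

/-- The inductive step: exactness modulo `I` gives `ker g = im f + I ker g`, and Nakayama concludes.
Flatness of the kernel, now the image of `f`, feeds the next degree. -/
theorem exact_and_flat_ker {I : Ideal R} (hI : I.FG) {f : A →ₗ[R] B} {g : B →ₗ[R] C}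
    [Module.Flat R B] [Module.Flat R (LinearMap.range g)] (hfg : g.comp f = 0)
    (h : ∀ x ∈ I, HomologyDerivedComplete x f g)
    (hmod : ∀ b, g b ∈ I • (⊤ : Submodule R C) → ∃ a, b - f a ∈ I • (⊤ : Submodule R B)) :
    LinearMap.range f = LinearMap.ker g ∧ Module.Flat R (LinearMap.ker g) := by
  refine ⟨le_antisymm (LinearMap.range_le_ker_iff.2 hfg) fun b hb => ?_, flat_ker g⟩
  refine HomologyDerivedComplete.exact_of_le_smul hI hfg h (fun z => ?_) b hb
  obtain ⟨a, ha⟩ := hmod z (by rw [z.2]; exact zero_mem _)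
  exact ⟨a, mem_smul_top_ker I g _ ha⟩

/-- A bounded below complex of flat modules which is exact modulo `I` and whose homology is
derived `I`-complete is exact. -/
theorem exact_of_exact_mod {I : Ideal R} (hI : I.FG) (E : ℕ → Type*) [∀ n, AddCommGroup (E n)]
    [∀ n, Module R (E n)] [∀ n, Module.Flat R (E n)] (d : ∀ n, E (n + 1) →ₗ[R] E n)
    (hd : ∀ n, (d n).comp (d (n + 1)) = 0)
    (h₀ : ∀ x ∈ I, HomologyDerivedComplete x (d 0) (0 : E 0 →ₗ[R] E 0))
    (h : ∀ x ∈ I, ∀ n, HomologyDerivedComplete x (d (n + 1)) (d n))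
    (hmod₀ : ∀ b, ∃ a, b - d 0 a ∈ I • (⊤ : Submodule R (E 0)))
    (hmod : ∀ n b, d n b ∈ I • (⊤ : Submodule R (E n)) →
      ∃ a, b - d (n + 1) a ∈ I • (⊤ : Submodule R (E (n + 1)))) :
    Function.Surjective (d 0) ∧ ∀ n, Function.Exact (d (n + 1)) (d n) := by
  have : Module.Flat R (LinearMap.range (0 : E 0 →ₗ[R] E 0)) := by
    rw [LinearMap.range_zero]; infer_instance
  obtain ⟨h1, h2⟩ := exact_and_flat_ker hI (LinearMap.zero_comp _) h₀ fun b _ => hmod₀ b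
  have hflat : ∀ n, Module.Flat R (LinearMap.range (d n)) := fun n => by
    induction n with
    | zero => rwa [h1]
    | succ n ih =>
      obtain ⟨h3, h4⟩ := exact_and_flat_ker hI (hd n) (fun x hx => h x hx n) (hmod n)
      rwa [h3]
  refine ⟨LinearMap.range_eq_top.1 (by rw [h1, LinearMap.ker_zero]), fun n => ?_⟩
  rw [LinearMap.exact_iff]
  have := hflat n
  exact (exact_and_flat_ker hI (hd n) (fun x hx => h x hx n) (hmod n)).1.symm

end FlatKernel

/-! ### Adic completion, Artin–Rees and flatness. -/

section Completion

variable {R : Type*} [CommRing R] {I : Ideal R}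

theorem pow_smul_val_eq_zero {M : Type*} [AddCommGroup M] [Module R M] {x : R} (hx : x ∈ I) (n : ℕ)
    (c : AdicCompletion I M) : x ^ n • c.val n = 0 := by
  rw [← AdicCompletion.val_smul_apply, ← AdicCompletion.eval_apply]
  exact AdicCompletion.pow_smul_top_le_ker_eval I n
    (Submodule.smul_mem_smul (Ideal.pow_mem_pow hx n) Submodule.mem_top)

/-- The solution is the series `m k = ∑ x ^ l • b (k + l)`, finite at level `n` because `x ^ n`
vanishes there. Uniqueness follows from `m k = x ^ n • m (k + n)`. -/
theorem derivedComplete_adicCompletion {M : Type*} [AddCommGroup M] [Module R M] {x : R}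
    (hx : x ∈ I) : DerivedComplete x (AdicCompletion I M) where
  exists_sub b := by
    have hcompat : ∀ k {i j : ℕ} (hij : i ≤ j), AdicCompletion.transitionMap I M hij
        (∑ l ∈ Finset.range j, x ^ l • (b (k + l)).val j) =
          ∑ l ∈ Finset.range i, x ^ l • (b (k + l)).val i := by
      intro k i j hij
      rw [map_sum, ← Finset.sum_subset (Finset.range_mono hij)]
      · exact Finset.sum_congr rfl fun l _ => by
          rw [map_smul]; exact congrArg _ ((b (k + l)).2 hij)
      · intro l _ hl
        rw [map_smul]
        refine (congrArg _ ((b (k + l)).2 hij)).trans ?_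
        obtain ⟨t, rfl⟩ := Nat.exists_eq_add_of_le (not_lt.1 (Finset.mem_range.not.1 hl))
        rw [add_comm, pow_add, mul_smul, pow_smul_val_eq_zero hx, smul_zero]
    let m : ℕ → AdicCompletion I M := fun k =>
      ⟨fun n => ∑ l ∈ Finset.range n, x ^ l • (b (k + l)).val n, hcompat k⟩
    refine ⟨m, fun k => AdicCompletion.ext fun n => ?_⟩
    have h := Finset.sum_range_succ' (fun l => x ^ l • (b (k + l)).val n) n
    rw [Finset.sum_range_succ, pow_smul_val_eq_zero hx, add_zero] at h
    rw [AdicCompletion.val_sub_apply, AdicCompletion.val_smul_apply]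
    change _ = (∑ l ∈ Finset.range n, x ^ l • (b (k + l)).val n) -
      x • ∑ l ∈ Finset.range n, x ^ l • (b (k + 1 + l)).val n
    rw [h, Finset.smul_sum]
    simp [pow_succ', mul_smul, add_assoc, add_comm 1]
  eq_zero m hm k := by
    have h : ∀ n k, m k = x ^ n • m (k + n) := fun n => by
      induction n with
      | zero => simp
      | succ n ih => intro k; rw [ih k, hm (k + n), pow_succ, mul_smul, add_assoc]
    refine AdicCompletion.ext fun n => ?_
    rw [h n k, AdicCompletion.val_smul_apply, pow_smul_val_eq_zero hx]
    rfl

theorem exists_sub_of_mem_smul (hI : I.FG) {M : Type*} [AddCommGroup M] [Module R M]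
    (c : AdicCompletion I M) :
    ∃ q, c - AdicCompletion.of I M q ∈ I • (⊤ : Submodule R (AdicCompletion I M)) := by
  obtain ⟨q, hq⟩ := Submodule.Quotient.mk_surjective _ (c.val 1)
  refine ⟨q, ?_⟩
  have h := AdicCompletion.pow_smul_top_eq_ker_eval (M := M) (n := 1) hI
  rw [show I • (⊤ : Submodule R (AdicCompletion I M)) = I ^ 1 • ⊤ by rw [pow_one], h,
    LinearMap.mem_ker, map_sub, AdicCompletion.eval_apply, ← hq, sub_eq_zero]
  rfl

theorem mem_smul_top_of_of_mem {M : Type*} [AddCommGroup M] [Module R M] (q : M)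
    (h : AdicCompletion.of I M q ∈ I • (⊤ : Submodule R (AdicCompletion I M))) :
    q ∈ I • (⊤ : Submodule R M) := by
  have h' := AdicCompletion.pow_smul_top_le_ker_eval I (M := M) 1 (by rwa [pow_one])
  rw [LinearMap.mem_ker, AdicCompletion.eval_of] at h'
  have := (Submodule.Quotient.mk_eq_zero _).1 h'
  rwa [pow_one] at this

/-- The Artin–Rees property of a linear map. -/
def ArtinRees (I : Ideal R) {M N : Type*} [AddCommGroup M] [Module R M] [AddCommGroup N]
    [Module R N] (f : M →ₗ[R] N) (k : ℕ) : Prop :=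
  ∀ n w, f w ∈ I ^ (n + k) • (⊤ : Submodule R N) →
    ∃ w' ∈ I ^ n • (⊤ : Submodule R M), f w' = f w

section Exact

variable {M N P : Type*} [AddCommGroup M] [Module R M] [AddCommGroup N] [Module R N]
  [AddCommGroup P] [Module R P] {f : M →ₗ[R] N} {g : N →ₗ[R] P}

/-- Artin–Rees bounds make completion preserve exactness without any finiteness of the modules. -/
theorem ArtinRees.exists_map_eq {k l : ℕ} (hf : ArtinRees I f k) (hg : ArtinRees I g l)
    (hfg : ∀ b, g b = 0 → ∃ a, f a = b) (y : AdicCompletion I N)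
    (hy : AdicCompletion.map I g y = 0) : ∃ z, AdicCompletion.map I f z = y := by
  obtain ⟨b, rfl⟩ := AdicCompletion.mk_surjective I N y
  have hb : ∀ n, g (b n) ∈ (I ^ n • ⊤ : Submodule R P) := fun n => by
    simpa using congrArg (fun x => x.val n) hy
  have hbb : ∀ {i j : ℕ}, i ≤ j → b j - b i ∈ (I ^ i • ⊤ : Submodule R N) := fun h =>
    (Submodule.Quotient.eq _).1 (AdicCompletion.AdicCauchySequence.mk_eq_mk h b)
  -- Subtracting `e n ∈ I ^ n` turns `b (n + l)` into an element of `ker g`, with preimage `a n`.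
  choose e he hge using fun n => hg n _ (hb (n + l))
  choose a ha using fun n => hfg (b (n + l) - e n) (by rw [map_sub, hge, sub_self])
  have hfa : ∀ n, f (a (n + k + 1) - a (n + k)) ∈ I ^ (n + k) • (⊤ : Submodule R N) := fun n => by
    rw [map_sub, ha, ha]
    have h1 : b (n + k + 1 + l) - b (n + k + l) ∈ I ^ (n + k) • (⊤ : Submodule R N) :=
      Submodule.smul_mono_left (Ideal.pow_le_pow_right (by lia)) (hbb (by lia))
    have h2 : e (n + k + 1) ∈ I ^ (n + k) • (⊤ : Submodule R N) :=
      Submodule.smul_mono_left (Ideal.pow_le_pow_right (by lia)) (he _)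
    convert add_mem (sub_mem h1 h2) (he (n + k)) using 1
    abel
  -- The lifts `a` need not be Cauchy; replacing their increments by `δ n ∈ I ^ n` with the same
  -- image gives the Cauchy sequence `s`.
  choose δ hδ hfδ using fun n => hf n _ (hfa n)
  let s : ℕ → M := fun n => a k + ∑ j ∈ Finset.range n, δ j
  have hfs : ∀ n, f (s n) = f (a (n + k)) := fun n => by
    induction n with
    | zero => simp [s]
    | succ n ih =>
      have : s (n + 1) = s n + δ n := by simp [s, Finset.sum_range_succ, add_assoc]
      rw [this, map_add, ih, hfδ, ← map_add, add_sub_cancel, add_right_comm]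
  refine ⟨AdicCompletion.mk I M (AdicCompletion.AdicCauchySequence.mk I M s fun n => ?_), ?_⟩
  · rw [SModEq.comm, SModEq.sub_mem]
    simpa [s, Finset.sum_range_succ] using hδ n
  · refine AdicCompletion.ext fun n => ?_
    suffices h : f (s n) - b n ∈ (I ^ n • ⊤ : Submodule R N) by
      simpa using (Submodule.Quotient.eq _).2 h
    rw [hfs, ha, sub_right_comm]
    exact sub_mem (hbb (by lia)) (Submodule.smul_mono_left (Ideal.pow_le_pow_right (by lia)) (he _))

end Exact

theorem exists_artinRees [IsNoetherianRing R] (I : Ideal R) {A B : Type*} [AddCommGroup A]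
    [Module R A] [AddCommGroup B] [Module R B] [Module.Finite R B] (f : A →ₗ[R] B) :
    ∃ k, ArtinRees I f k := by
  obtain ⟨k, hk⟩ := Ideal.exists_pow_inf_eq_pow_smul I (LinearMap.range f)
  refine ⟨k, fun n w hw => ?_⟩
  have h : f w ∈ I ^ (n + k) • (⊤ : Submodule R B) ⊓ LinearMap.range f := ⟨hw, w, rfl⟩
  rw [hk (n + k) (by lia), Nat.add_sub_cancel] at h
  have h' := (smul_mono_right (I ^ n) inf_le_right : _ ≤ I ^ n • LinearMap.range f) h
  rw [← Submodule.map_top, ← Submodule.map_smul''] at h'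
  exact h'

/-- One constant `k` serves all coordinates, so `X` may be infinite. -/
theorem ArtinRees.finsupp {A B : Type*} [AddCommGroup A]
    [Module R A] [AddCommGroup B] [Module R B] {f : A →ₗ[R] B} {k : ℕ} (hf : ArtinRees I f k)
    (X : Type*) : ArtinRees I (Finsupp.mapRange.linearMap (α := X) f) k := by
  intro n w hw
  have : ∀ x, ∃ w' ∈ I ^ n • (⊤ : Submodule R A), f w' = f (w x) := fun x =>
    hf n _ (by simpa using map_mem_smul_top (Finsupp.lapply x) hw)
  choose w' hw' hfw using this
  refine ⟨∑ x ∈ w.support, Finsupp.single x (w' x),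
    sum_mem fun x _ => map_mem_smul_top (Finsupp.lsingle x) (hw' x), ?_⟩
  conv_rhs => rw [← Finsupp.sum_single w, Finsupp.sum, map_sum]
  simp [hfw]

theorem finsupp_exact {A B C : Type*} [AddCommGroup A] [Module R A] [AddCommGroup B] [Module R B]
    [AddCommGroup C] [Module R C] {f : A →ₗ[R] B} {g : B →ₗ[R] C}
    (hfg : ∀ b, g b = 0 → ∃ a, f a = b) (X : Type*) (w : X →₀ B)
    (hw : Finsupp.mapRange.linearMap g w = 0) :
    ∃ t : X →₀ A, Finsupp.mapRange.linearMap f t = w := by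
  choose t ht using fun x => hfg (w x) (by simpa using DFunLike.congr_fun hw x)
  refine ⟨∑ x ∈ w.support, Finsupp.single x (t x), ?_⟩
  conv_rhs => rw [← Finsupp.sum_single w, Finsupp.sum]
  simp [ht]

/-- `AdicCompletion.map` as a linear map in the morphism. -/
noncomputable def completionMap (I : Ideal R) (M N : Type*) [AddCommGroup M] [Module R M]
    [AddCommGroup N] [Module R N] :
    (M →ₗ[R] N) →ₗ[R] (AdicCompletion I M →ₗ[R] AdicCompletion I N) where
  toFun f := (AdicCompletion.map I f).restrictScalars R
  map_add' f g := by
    ext a n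
    rfl
  map_smul' r f := by
    ext a n
    rfl

theorem completionMap_comp_apply {M N P : Type*} [AddCommGroup M] [Module R M] [AddCommGroup N]
    [Module R N] [AddCommGroup P] [Module R P] (f : M →ₗ[R] N) (g : N →ₗ[R] P)
    (x : AdicCompletion I M) :
    completionMap I N P g (completionMap I M N f x) = completionMap I M P (g ∘ₗ f) x :=
  AdicCompletion.map_comp_apply I f g x

theorem completionMap_id {M : Type*} [AddCommGroup M] [Module R M] :
    completionMap I M M LinearMap.id = LinearMap.id := by
  ext a n
  rfl

/-- Equational criterion: a relation with coefficients `a` is a vector killed by `g`. Exactness of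
`R^s → R^l → R` persists for the completed direct sums, so the vector comes from some `z`, and the
matrix of `f` trivialises the relation. -/
theorem flat_adicCompletion_finsupp [IsNoetherianRing R] (I : Ideal R) (X : Type*) :
    Module.Flat R (AdicCompletion I (X →₀ R)) := by
  refine Module.Flat.of_forall_isTrivialRelation fun {l a c} hac => ?_
  let g : (Fin l → R) →ₗ[R] R := ∑ i, a i • LinearMap.proj i
  obtain ⟨s, f, hf⟩ : ∃ (s : ℕ) (f : (Fin s → R) →ₗ[R] (Fin l → R)),
      LinearMap.range f = LinearMap.ker g := by
    obtain ⟨s, f, hf⟩ := Module.Finite.exists_fin' R (LinearMap.ker g)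
    refine ⟨s, (LinearMap.ker g).subtype ∘ₗ f, ?_⟩
    rw [LinearMap.range_comp, LinearMap.range_eq_top.2 hf, Submodule.map_top,
      Submodule.range_subtype]
  obtain ⟨k₁, h₁⟩ := exists_artinRees I f
  obtain ⟨k₂, h₂⟩ := exists_artinRees I g
  let E (k : ℕ) (i : Fin k) : (X →₀ R) →ₗ[R] (X →₀ (Fin k → R)) :=
    Finsupp.mapRange.linearMap (LinearMap.single R (fun _ : Fin k => R) i)
  let p (k : ℕ) (i : Fin k) : (X →₀ (Fin k → R)) →ₗ[R] (X →₀ R) :=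
    Finsupp.mapRange.linearMap (LinearMap.proj i)
  have hgE : ∀ i, Finsupp.mapRange.linearMap g ∘ₗ E l i = a i • LinearMap.id := fun i => by
    ext x y
    simp [E, g, Pi.single_apply]
  have hpE : ∀ i j, p l i ∘ₗ E l j = if i = j then LinearMap.id else 0 := fun i j => by
    ext x y
    split_ifs with h
    · subst h; simp [E, p]
    · simp [E, p, h]
  have hpf : ∀ i, p l i ∘ₗ Finsupp.mapRange.linearMap f =
      ∑ j, f (Pi.single j 1) i • p s j := fun i => by
    ext x t y
    simp only [LinearMap.comp_apply, LinearMap.sum_apply, Finsupp.finsetSum_apply]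
    rw [Finset.sum_eq_single t]
    · simp [p]
    · intro j _ hj
      simp [p, hj]
    · simp
  let Λ := completionMap I
  obtain ⟨z, hz⟩ := (h₁.finsupp X).exists_map_eq (h₂.finsupp X)
    (finsupp_exact (fun b hb => hf.ge hb) X) (∑ i, Λ _ _ (E l i) (c i)) (by
      change Λ _ _ _ _ = 0
      rw [map_sum, ← hac]
      refine Finset.sum_congr rfl fun i _ => ?_
      rw [completionMap_comp_apply, hgE, map_smul, completionMap_id]
      rfl)
  refine ⟨s, fun i j => f (Pi.single j 1) i, fun j => Λ _ _ (p s j) z, fun i => ?_, fun j => ?_⟩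
  · have h := congrArg (Λ _ _ (p l i)) hz
    change Λ _ _ _ (Λ _ _ _ z) = _ at h
    rw [completionMap_comp_apply, hpf, map_sum, map_sum] at h
    simp only [Λ, completionMap_comp_apply, hpE] at h
    simp [apply_ite, completionMap_id] at h
    rw [Finset.sum_eq_single i (fun j _ hj => by simp [hj.symm]) (by simp), if_pos rfl] at h
    exact h.symm
  · have h : g (f (Pi.single j 1)) = 0 := hf.le ⟨_, rfl⟩
    simpa [g] using h

theorem flat_adicCompletion [IsNoetherianRing R] (I : Ideal R) (P : Type*) [AddCommGroup P]
    [Module R P] [Module.Projective R P] : Module.Flat R (AdicCompletion I P) := by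
  obtain ⟨s, hs⟩ := Module.projective_def'.1 ‹Module.Projective R P›
  have := flat_adicCompletion_finsupp I P
  refine Module.Flat.of_retract (completionMap I _ _ s)
    (completionMap I _ _ (Finsupp.linearCombination R id)) (LinearMap.ext fun x => ?_)
  rw [LinearMap.comp_apply, completionMap_comp_apply, hs, completionMap_id]

end Completion

/-! ### The cone of a resolution mapping to its completion. -/

section Resolution

variable {R : Type*} [CommRing R]

/-- The terms of a chain complex shifted up by one degree. -/
def shiftObj (P : ℕ → Type v) : ℕ → Type v
  | 0 => PUnit.{v + 1}
  | n + 1 => P n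

instance (P : ℕ → Type v) [∀ n, AddCommGroup (P n)] : ∀ n, AddCommGroup (shiftObj P n)
  | 0 => inferInstanceAs (AddCommGroup PUnit.{v + 1})
  | n + 1 => inferInstanceAs (AddCommGroup (P n))

instance (P : ℕ → Type v) [∀ n, AddCommGroup (P n)] [∀ n, Module R (P n)] :
    ∀ n, Module R (shiftObj P n)
  | 0 => inferInstanceAs (Module R PUnit.{v + 1})
  | n + 1 => inferInstanceAs (Module R (P n))

instance (P : ℕ → Type v) : Subsingleton (shiftObj P 0) :=
  inferInstanceAs (Subsingleton PUnit.{v + 1})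

instance (P : ℕ → Type v) [∀ n, AddCommGroup (P n)] [∀ n, Module R (P n)]
    [∀ n, Module.Flat R (P n)] : ∀ n, Module.Flat R (shiftObj P n)
  | 0 => inferInstanceAs (Module.Flat R PUnit.{v + 1})
  | n + 1 => inferInstanceAs (Module.Flat R (P n))

/-- The differential of a chain complex shifted up by one degree. -/
def shiftMap {P : ℕ → Type v} [∀ n, AddCommGroup (P n)] [∀ n, Module R (P n)]
    (d : ∀ n, P (n + 1) →ₗ[R] P n) : ∀ n, shiftObj P (n + 1) →ₗ[R] shiftObj P n
  | 0 => 0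
  | n + 1 => d n

instance flat_prod {M N : Type*} [AddCommGroup M] [Module R M] [AddCommGroup N] [Module R N]
    [Module.Flat R M] [Module.Flat R N] : Module.Flat R (M × N) := by
  rw [Module.Flat.iff_rTensor_injective']
  intro I
  have hM := (Module.Flat.iff_rTensor_injective' (M := M)).1 ‹_› I
  have hN := (Module.Flat.iff_rTensor_injective' (M := N)).1 ‹_› I
  have h : (TensorProduct.prodRight R R R M N).toLinearMap ∘ₗ I.subtype.rTensor (M × N) =
      (I.subtype.rTensor M).prodMap (I.subtype.rTensor N) ∘ₗ
        (TensorProduct.prodRight R R I M N).toLinearMap :=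
    TensorProduct.ext' fun r x => by simp
  refine Function.Injective.of_comp (f := TensorProduct.prodRight R R R M N) ?_
  have h' := (hM.prodMap hN).comp (TensorProduct.prodRight R R I M N).injective
  intro x y hxy
  exact h' ((LinearMap.congr_fun h x).symm.trans (hxy.trans (LinearMap.congr_fun h y)))

/-- The conclusions spell out that `P → Λ(P)` is a quasi-isomorphism, read off from exactness of the
cone with terms `P (n - 1) × Λ (P n)`. -/
theorem completion_exact_of_derivedComplete [IsNoetherianRing R] (I : Ideal R) {P : ℕ → Type v}
    [∀ n, AddCommGroup (P n)] [∀ n, Module R (P n)] [∀ n, Module.Projective R (P n)]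
    (d : ∀ n, P (n + 1) →ₗ[R] P n) (hd : ∀ n, Function.Exact (d (n + 1)) (d n))
    {N : Type*} [AddCommGroup N] [Module R N] (hN : ∀ x ∈ I, DerivedComplete x N)
    (ε : P 0 →ₗ[R] N) (hε : Function.Surjective ε) (hdε : Function.Exact (d 0) ε) :
    (∀ c, ∃ p c', AdicCompletion.of I (P 0) p + completionMap I _ _ (d 0) c' = c) ∧
      (∀ p c', completionMap I _ _ (d 0) c' = AdicCompletion.of I (P 0) p → ε p = 0) ∧
      ∀ n c, completionMap I _ _ (d n) c = 0 → ∃ c', completionMap I _ _ (d (n + 1)) c' = c := by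
  have hI : I.FG := IsNoetherian.noetherian I
  have hfl : ∀ n, Module.Flat R (AdicCompletion I (P n)) := fun n => flat_adicCompletion I (P n)
  let δ n := completionMap I _ _ (d n)
  let η n : shiftObj P (n + 1) →ₗ[R] AdicCompletion I (P n) := AdicCompletion.of I (P n)
  let D := shiftMap d
  have hδ : ∀ n, (δ n).comp (δ (n + 1)) = 0 := fun n => LinearMap.ext fun c => by
    rw [LinearMap.comp_apply, completionMap_comp_apply, (hd n).linearMap_comp_eq_zero, map_zero]
  have hD : ∀ n, (D n).comp (D (n + 1)) = 0 := fun n => by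
    cases n with
    | zero => exact LinearMap.ext fun _ => Subsingleton.elim _ _
    | succ n => exact (hd n).linearMap_comp_eq_zero
  have hη : ∀ n, (η n).comp (D (n + 1)) = (δ n).comp (η (n + 1)) := fun n => rfl
  have hDexact : ∀ x ∈ I, ∀ n, HomologyDerivedComplete x (D (n + 1)) (D n) := fun x hx n => by
    cases n with
    | zero =>
      exact HomologyDerivedComplete.of_cokernel (hN x hx) (d 0) (D 0) (fun _ => rfl) ε hε hdε
    | succ n => exact .of_exact x fun b hb => (hd n b).1 hb
  have hdc : ∀ x ∈ I, ∀ n, DerivedComplete x (AdicCompletion I (P n)) :=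
    fun x hx n => derivedComplete_adicCompletion hx
  have h0 : ∀ x ∈ I, DerivedComplete x PUnit.{1} := fun x _ =>
    ⟨fun _ => ⟨0, fun _ => rfl⟩, fun _ _ _ => rfl⟩
  obtain ⟨h1, h2⟩ := exact_of_exact_mod hI (fun n => shiftObj P n × AdicCompletion I (P n))
    (fun n => coneMap (D n) (δ n) (η n)) (fun n => coneMap_comp (hD n) (hδ n) (hη n))
    -- In degree 0 the complexes are padded by zero modules so that the cone lemma still applies.
    (fun x hx => by
      have h := HomologyDerivedComplete.cone (x := x) (d₁ := (0 : shiftObj P 0 →ₗ[R] PUnit.{1}))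
        (d₂ := D 0) (d₃ := D 1)
        (δ₁ := (0 : PUnit.{1} →ₗ[R] PUnit.{1}))
        (δ₂ := (0 : AdicCompletion I (P 0) →ₗ[R] PUnit.{1})) (δ₃ := δ 0) (η₁ := 0) (η₂ := η 0)
        rfl rfl rfl rfl (fun _ _ => rfl) (.of_exact x fun _ _ => ⟨0, Subsingleton.elim _ _⟩)
        (hDexact x hx 0) (fun p => ⟨η 1 p, rfl⟩) ((hdc x hx 0).homology (h0 x hx) (h0 x hx) _ _)
        ((hdc x hx _).homology (hdc x hx _) (h0 x hx) _ _)
      refine ⟨fun b _ => ?_, fun m a _ => h.eq_boundary m a fun _ => rfl⟩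
      obtain ⟨m, a, -, hma⟩ := h.exists_sub b fun _ => rfl
      exact ⟨m, a, fun _ => rfl, hma⟩)
    (fun x hx n => by
      cases n with
      | zero =>
        exact .cone (δ₁ := (0 : AdicCompletion I (P 0) →ₗ[R] PUnit.{1})) rfl (hδ 0) (hD 0) (hη 0)
          (fun _ _ => rfl) (hDexact x hx 0) (hDexact x hx 1) (fun p => ⟨η 2 p, rfl⟩)
          ((hdc x hx _).homology (hdc x hx _) (h0 x hx) _ _)
          ((hdc x hx _).homology (hdc x hx _) (hdc x hx _) _ _)
      | succ n =>
        refine .cone (hδ n) (hδ (n + 1)) (hD (n + 1)) (hη (n + 1)) (fun p hp => ?_)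
          (hDexact x hx (n + 1)) (hDexact x hx (n + 2)) (fun p => ⟨η (n + 3) p, rfl⟩)
          ((hdc x hx _).homology (hdc x hx _) (hdc x hx _) _ _)
          ((hdc x hx _).homology (hdc x hx _) (hdc x hx _) _ _)
        exact (congrArg (η n) hp).trans (map_zero _))
    (fun b => cone_exists_sub_mem_smul (d₁ := (0 : shiftObj P 0 →ₗ[R] PUnit.{1}))
        (d₂ := D 0) (δ₂ := (0 : AdicCompletion I (P 0) →ₗ[R] PUnit.{1})) (δ 0)
        (η₁ := 0) (η₂ := η 0) rfl (exists_sub_of_mem_smul hI)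
        (fun p _ => by rw [Subsingleton.elim p 0]; exact zero_mem _) b
        (by rw [Subsingleton.elim (coneMap _ _ _ b) 0]; exact zero_mem _))
    (fun n b => cone_exists_sub_mem_smul _ (hη n) (exists_sub_of_mem_smul hI)
      (fun p hp => mem_smul_top_of_of_mem (M := P n) p hp) b)
  refine ⟨fun c => ?_, fun p c' h => ?_, fun n c hc => ?_⟩
  · obtain ⟨⟨p, c'⟩, h⟩ := h1 (0, c)
    exact ⟨p, c', congrArg Prod.snd h⟩
  · obtain ⟨⟨q, c⟩, h⟩ := (h2 0 (p, -c')).1 (Prod.ext (Subsingleton.elim _ _) (by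
      change AdicCompletion.of I (P 0) p + completionMap I _ _ (d 0) (-c') = 0
      rw [map_neg, h, add_neg_cancel]))
    have h' : -d 0 q = p := congrArg Prod.fst h
    rw [← h', map_neg, (hdε _).2 ⟨q, rfl⟩, neg_zero]
  · obtain ⟨⟨p, c'⟩, h⟩ := (h2 n (0, c)).1 (Prod.ext (by simp) (by
      change η n 0 + δ n c = 0
      rw [map_zero, zero_add]; exact hc))
    have hp : -D (n + 1) p = 0 := congrArg Prod.fst h
    have hc' : η (n + 1) p + δ (n + 1) c' = c := congrArg Prod.snd h
    -- As `p` is a cycle of an exact complex, `p = d q`, and its contribution moves into the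
    -- completed part as the image of `q`.
    obtain ⟨q, rfl⟩ := (hd n p).1 (neg_eq_zero.1 hp)
    refine ⟨AdicCompletion.of I _ q + c', ?_⟩
    rw [map_add]
    exact hc'

end Resolution

/-! ### Transfer to local homology modules. -/

section Homology

variable {R : Type u} [CommRing R]

theorem iCycles_eq_iff (S : ShortComplex (ModuleCat.{v} R)) (b : S.X₂) :
    S.g b = 0 ↔ ∃ z, S.iCycles z = b := by
  constructor
  · intro h
    refine ⟨S.moduleCatCyclesIso.inv ⟨b, h⟩, ?_⟩
    exact congr($(S.moduleCatCyclesIso_inv_iCycles) ⟨b, h⟩)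
  · rintro ⟨z, rfl⟩
    exact congr($(S.iCycles_g) z)

theorem homologyπ_eq_zero_iff (S : ShortComplex (ModuleCat.{v} R)) (z : S.cycles) :
    S.homologyπ z = 0 ↔ ∃ a, S.f a = S.iCycles z := by
  have hinj : Function.Injective S.iCycles := (ModuleCat.mono_iff_injective _).1 inferInstance
  have hinj' : Function.Injective S.homologyι := (ModuleCat.mono_iff_injective _).1 inferInstance
  have h : S.homologyι (S.homologyπ z) = S.pOpcycles (S.iCycles z) :=
    congr($(S.homology_π_ι) z)
  rw [← map_eq_zero_iff S.homologyι.hom hinj']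
  exact (iff_of_eq (congrArg (· = 0) h)).trans (S.moduleCat_pOpcycles_eq_zero_iff _)

theorem homologyπ_surjective (S : ShortComplex (ModuleCat.{v} R)) :
    Function.Surjective S.homologyπ := (ModuleCat.epi_iff_surjective _).1 inferInstance

theorem derivedComplete_homology {x : R} (S : ShortComplex (ModuleCat.{v} R))
    (h₁ : DerivedComplete x S.X₁) (h₂ : DerivedComplete x S.X₂) (h₃ : DerivedComplete x S.X₃) :
    DerivedComplete x S.homology :=
  (h₁.homology h₂ h₃ S.f.hom S.g.hom).derivedComplete S.iCycles.hom
    (iCycles_eq_iff S) S.homologyπ.hom (homologyπ_surjective S) (homologyπ_eq_zero_iff S)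

theorem DerivedComplete.of_iso {x : R} {M N : ModuleCat.{v} R} (e : M ≅ N)
    (h : DerivedComplete x M) : DerivedComplete x N where
  exists_sub b := by
    obtain ⟨m, hm⟩ := h.exists_sub fun k => e.inv (b k)
    refine ⟨fun k => e.hom (m k), fun k => ?_⟩
    have := congrArg e.hom (hm k)
    simpa using this
  eq_zero m hm k := by
    have := h.eq_zero (fun k => e.inv (m k)) (fun k => by rw [← map_smul, ← hm]) k
    simpa using congrArg e.hom this

theorem derivedComplete_localHomology [Small.{v} R] {𝔞 : Ideal R} {x : R} (hx : x ∈ 𝔞)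
    (j : ℕ) (M : ModuleCat.{v} R) : DerivedComplete x (localHomology 𝔞 j M) :=
  .of_iso (localHomologyIso 𝔞 j (projectiveResolution M)).symm
    (derivedComplete_homology _ (derivedComplete_adicCompletion hx)
      (derivedComplete_adicCompletion hx) (derivedComplete_adicCompletion hx))

/-- The predecessor of `i` in the complex shape equals `i + 1` only propositionally. -/
theorem range_sc_f (C : ChainComplex (ModuleCat.{v} R) ℕ) (i : ℕ) :
    LinearMap.range (C.sc i).f.hom = LinearMap.range (C.d (i + 1) i).hom := by
  have h : ∀ k, k = i + 1 →
      LinearMap.range (C.d k i).hom = LinearMap.range (C.d (i + 1) i).hom := by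
    rintro _ rfl
    rfl
  exact h _ (ChainComplex.prev ℕ i)

/-- Linear maps out of the same module with the same kernel have isomorphic images. -/
noncomputable def isoOfKerEq {A M N : ModuleCat.{v} R} (φ : A →ₗ[R] M) (ψ : A →ₗ[R] N)
    (hφ : Function.Surjective φ) (hψ : Function.Surjective ψ)
    (h : LinearMap.ker φ = LinearMap.ker ψ) : M ≅ N :=
  ((φ.quotKerEquivOfSurjective hφ).symm ≪≫ₗ Submodule.quotEquivOfEq _ _ h ≪≫ₗ
    ψ.quotKerEquivOfSurjective hψ).toModuleIso

theorem nonempty_iso_and_isZero [Small.{v} R] [IsNoetherianRing R] (𝔞 : Ideal R)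
    (N : ModuleCat.{v} R) (hN : ∀ x ∈ 𝔞, DerivedComplete x N) :
    Nonempty (localHomology 𝔞 0 N ≅ N) ∧ ∀ i, 1 ≤ i → IsZero (localHomology 𝔞 i N) := by
  let P := projectiveResolution N
  let e : ((ChainComplex.single₀ (ModuleCat.{v} R)).obj N).X 0 ≅ N :=
    HomologicalComplex.singleObjXSelf _ _ _
  have hP : ∀ n, Module.Projective R (P.complex.X n) := fun n => inferInstance
  have hsurj : Function.Surjective (P.π.f 0).hom :=
    (ModuleCat.epi_iff_surjective _).1 inferInstance
  have hexact : Function.Exact (P.complex.d 1 0).hom (P.π.f 0).hom :=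
    (ShortComplex.ShortExact.moduleCat_exact_iff_function_exact _).1 P.exact₀
  obtain ⟨h1, h2, h3⟩ := completion_exact_of_derivedComplete 𝔞 (P := fun n => P.complex.X n)
    (fun n => (P.complex.d (n + 1) n).hom)
    (fun n => (ShortComplex.ShortExact.moduleCat_exact_iff_function_exact _).1 (P.exact_succ n))
    (fun x hx => (hN x hx).of_iso e.symm) (P.π.f 0).hom hsurj hexact
  let C := ((completionFunctor.{v} 𝔞).mapHomologicalComplex (ComplexShape.down ℕ)).obj P.complex
  have hd : ∀ n, (C.d (n + 1) n).hom = completionMap 𝔞 _ _ (P.complex.d (n + 1) n).hom :=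
    fun n => rfl
  refine ⟨⟨localHomologyIso 𝔞 0 P ≪≫ ChainComplex.isoHomologyι₀ C ≪≫ ?_ ≪≫ e⟩, fun i hi => ?_⟩
  · have hp : Function.Surjective (C.pOpcycles 0).hom :=
      (ModuleCat.epi_iff_surjective _).1 inferInstance
    have hker : ∀ c, (C.pOpcycles 0).hom c = 0 ↔ c ∈ LinearMap.range (C.d 1 0).hom := fun c => by
      rw [← range_sc_f C 0]
      exact (C.sc 0).moduleCat_pOpcycles_eq_zero_iff c
    -- `P₀` maps onto both `coker Λ(d)` and `N`, with the same kernel.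
    refine isoOfKerEq ((C.pOpcycles 0).hom ∘ₗ AdicCompletion.of 𝔞 (P.complex.X 0)) (P.π.f 0).hom
      (fun q => ?_) hsurj (Submodule.ext fun p => ⟨fun h => ?_, fun h => ?_⟩)
    · obtain ⟨c, rfl⟩ := hp q
      obtain ⟨p, c', rfl⟩ := h1 c
      refine ⟨p, ?_⟩
      have h := (hker _).2 ⟨c', rfl⟩
      exact (((C.pOpcycles 0).hom.map_add _ _).trans ((congrArg _ h).trans (add_zero _))).symm
    · obtain ⟨c', hc'⟩ := (hker _).1 h
      exact h2 p c' hc'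
    · obtain ⟨q, rfl⟩ := (hexact p).1 h
      exact (hker _).2 ⟨AdicCompletion.of 𝔞 _ q, rfl⟩
  · obtain ⟨n, rfl⟩ := Nat.exists_eq_add_of_le' hi
    refine IsZero.of_iso (HomologicalComplex.ExactAt.isZero_homology (K := C) ?_)
      (localHomologyIso 𝔞 (n + 1) P)
    rw [C.exactAt_iff' (n + 2) (n + 1) n (ChainComplex.prev ℕ _) (ChainComplex.next_nat_succ n),
      ShortComplex.moduleCat_exact_iff]
    exact h3 n

end Homology

end LocalHomology

theorem lemma2p4 {R : Type u} [CommRing R] [IsNoetherianRing R] [Small.{v} R] (𝔞 : Ideal R)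
    (M : ModuleCat.{v} R) (j : ℕ) :
    Nonempty (LocalHomology.localHomology 𝔞 0 (LocalHomology.localHomology 𝔞 j M) ≅
        LocalHomology.localHomology 𝔞 j M) ∧
      ∀ i : ℕ, 1 ≤ i →
        IsZero (LocalHomology.localHomology 𝔞 i (LocalHomology.localHomology 𝔞 j M)) := by
  exact LocalHomology.nonempty_iso_and_isZero 𝔞 _ fun _ hx =>
    LocalHomology.derivedComplete_localHomology hx j M
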